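/- **Setting.** There are $n=3t+1$ replicas, $t\ge 1$; $B$ denotes the set of Byzantine replicas, $f=|B|$, and the Byzantine fraction exceeds $1/3$ exactly when $f>t$. *Committees and coins.* In every step each replica is in the committee of that step with probability $\kappa/n$, where $0<\kappa\le n$ is the expected committee size; every step has a fair global coin; all these choices are independent. The vote threshold is an integer $t_H$ with $t_H\ge 2\kappa/3$ and $2\le t_H\le 2t+1$. *BBA\*.* The network is synchronous: every vote sent in step $s$ is received before step $s+1$. Each replica $r$ enters with a value $v_r$ and a grade $g_r\in\{0,1,2\}$ from graded consensus, which is assumed to have worked: for honest replicas, $g_r=0$ iff $v_r=v_\perp$, grades differ by at most $1$, and values with nonzero grades are equal. Put $b_r=0$ if $g_r=2$, and $b_r=1$ otherwise. In step 4 every honest committee member broadcasts its vote $(b_r,v_r)$. In a step $s\ge5$ an honest replica that has not ended does the following with the votes received from step $s-1$ (votes are counted by senders). * $s\equiv2 \pmod 3$: if it has $\ge t_H$ votes on one tuple $(0,v)$, it outputs $(0,v)$ and ends. Otherwise $b_r\gets1$ if it has $\ge t_H$ votes with bit $1$, else $b_r\gets0$. * $s\equiv0 \pmod 3$: if it has $\ge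 t_H$ votes with bit $1$ (and any values), it outputs $(1,v_\perp)$ and ends. Otherwise $b_r\gets0$ if it has $\ge t_H$ votes with bit $0$, else $b_r\gets1$. * $s\equiv1 \pmod 3$: $b_r\gets0$ if it has $\ge t_H$ votes with bit $0$; else $b_r\gets1$ if it has $\ge t_H$ votes with bit $1$; else $b_r$ becomes the coin of step $s$. If it has not ended and is in the committee of step $s$, it then broadcasts its vote $(b_r,v_r)$. A Byzantine replica may send any votes, signed by itself, to any replicas, but only in steps for which it is in the committee. *Evidence.* The client collects responses from replicas. A response consists of the replica's input to BBA\*, all votes it received, and its output. Responses of honest replicas are truthful; those of Byzantine replicas are arbitrary, except that every vote in them comes from a member of the committee of its step and votes of honest replicas cannot be forged. A *forensic protocol* $A$ maps the evidence (and the committees and coins) to a set of accused replicas. *Forensic support.* Algorand has $(m,k,d)$-*forensic support with error $\delta$* if there is an $A$ such that the following hold. 1. (Irrefutability) For every $B$, of any size, except on a set of committees and coins of probability at most $\delta$, in all executions with Byzantine set $B$ and for all evidence possible in them, every replica accused by $A$ is in $B$. 2. (Identification) For every $B$ with $t<|B|\le m$, except on a set of committees and coins of probability at most $\delta$: in all executions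 with Byzantine set $B$ in which two honest replicas output conflicting (unequal) tuples, and for all evidence with the responses of at least $k$ honest replicas, $A$ accuses at least $d$ replicas, all of them in $B$. **Theorem 6.1.** For all $t$, $\kappa$, $t_H$ as above there is $\delta>0$ such that, for every $d>0$, Algorand's BBA\* with committee self-selection does not have $(t+1,2t,d)$-forensic support with error $\delta$. In fact no $A$ satisfies even condition 2 alone (with $m=t+1$, $k=2t$). In particular, there is no $(t+1,2t,d)$-forensic support with certainty. -/

import Mathlib

open MeasureTheory ProbabilityTheory
open scoped ENNReal

namespace Algorand

/-- A vote `(b, v)`: the bit `b` (`false` is `0`, `true` is `1`) and a value, where `none` is the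
default value `v_⊥`. Outputs of the protocol have the same form. -/
abbrev Vote (V : Type*) := Bool × Option V

/-- What a replica obtains from graded consensus: a value (`none` is `v_⊥`) and a grade. -/
structure GradedOutput (V : Type*) where
  value : Option V
  grade : Fin 3

/-- The input bit to BBA*: `0` if the grade is `2`, and `1` otherwise. -/
def GradedOutput.bit {V : Type*} (g : GradedOutput V) : Bool :=
  if g.grade = 2 then false else true

/-- A replica is either running, with its current bit, or it has output a tuple and stopped. -/
inductive Status (V : Type*) where
  | running (b : Bool) : Status V
  | ended (o : Vote V) : Status V

/-- The number of replicas from which a vote with property `p` was received, where `recv j` is the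
set of (valid) votes received from `j`. -/
noncomputable def votes {V : Type*} {n : ℕ} (recv : Fin n → Set (Vote V)) (p : Vote V → Prop) :
    ℕ :=
  {j : Fin n | ∃ x ∈ recv j, p x}.ncard

/-- The ending conditions at step `s`, given the votes `recv` of the previous step. Ending
Condition 0 is checked at the steps `s ≡ 2 mod 3` and asks for `tH` votes on one tuple `(0, v)`;
Ending Condition 1 is checked at the steps `s ≡ 0 mod 3` and asks for `tH` votes on the bit `1`,
with any values, and the output is `(1, v_⊥)`. -/
def Ends {V : Type*} {n : ℕ} (tH s : ℕ) (recv : Fin n → Set (Vote V)) (o : Vote V) : Prop :=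
  (s % 3 = 2 ∧ o.1 = false ∧ tH ≤ votes recv (fun x => x = o)) ∨
  (s % 3 = 0 ∧ o = (true, none) ∧ tH ≤ votes recv (fun x => x.1 = true))

/-- The bit of a replica that does not end at step `s`: Coin-Fixed-To-0 for `s ≡ 2`,
Coin-Fixed-To-1 for `s ≡ 0`, Coin-Genuinely-Flipped for `s ≡ 1 mod 3`. -/
noncomputable def newBit {V : Type*} {n : ℕ} (tH s : ℕ) (coin : Bool)
    (recv : Fin n → Set (Vote V)) : Bool :=
  if s % 3 = 2 then
    if tH ≤ votes recv (fun x => x.1 = true) then true else false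
  else if s % 3 = 0 then
    if tH ≤ votes recv (fun x => x.1 = false) then false else true
  else
    if tH ≤ votes recv (fun x => x.1 = false) then false
    else if tH ≤ votes recv (fun x => x.1 = true) then true
    else coin

/-- The transition of an honest replica at step `s ≥ 5`. -/
def Next {V : Type*} {n : ℕ} (tH s : ℕ) (coin : Bool) (recv : Fin n → Set (Vote V)) :
    Status V → Status V → Prop
  | .ended o, σ => σ = .ended o
  | .running _, σ =>
      (∃ o, Ends tH s recv o ∧ σ = .ended o) ∨
      ((∀ o, ¬ Ends tH s recv o) ∧ σ = .running (newBit tH s coin recv))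

/-- A synchronous execution of BBA* by `n` replicas with threshold `tH`, in which `byz` is the set
of Byzantine replicas, `comm s` is the self-selected committee of step `s`, and `coin s` is the
global coin of step `s`. Steps are numbered from the start of graded consensus, so that BBA*
consists of the steps `s ≥ 4`. -/
structure Execution (V : Type*) (n tH : ℕ) (comm : ℕ → Finset (Fin n)) (coin : ℕ → Bool)
    (byz : Finset (Fin n)) where
  /-- the outputs of graded consensus -/
  input : Fin n → GradedOutput V
  /-- `status s i` is the status of replica `i` after its update at step `s` -/
  status : ℕ → Fin n → Status V
  /-- `sent s i j` is the set of votes of step `s`, signed by `i`, that `i` sends to `j`; they are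
  delivered before step `s + 1` -/
  sent : ℕ → Fin n → Fin n → Set (Vote V)
  /-- graded consensus has worked: grade `0` goes with the value `v_⊥`, -/
  graded_value : ∀ i, i ∉ byz → ((input i).value = none ↔ (input i).grade = 0)
  /-- honest grades differ by at most one, -/
  graded_close : ∀ i j, i ∉ byz → j ∉ byz → ((input i).grade : ℕ) ≤ (input j).grade + 1
  /-- and honest replicas with nonzero grades have the same value -/
  graded_agree : ∀ i j, i ∉ byz → j ∉ byz → (input i).grade ≠ 0 → (input j).grade ≠ 0 →
    (input i).value = (input j).value
  /-- a valid vote of step `s` carries a proof that its sender is in the committee of step `s`, also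
  when the sender is Byzantine (otherwise what a Byzantine replica sends, and to whom, is free) -/
  selected : ∀ s i j x, x ∈ sent s i j → 4 ≤ s ∧ i ∈ comm s
  /-- honest replicas start with the input bit -/
  start : ∀ i, i ∉ byz → status 4 i = .running (input i).bit
  /-- honest replicas update according to the votes received from the previous step -/
  step : ∀ s i, 4 ≤ s → i ∉ byz →
    Next tH (s + 1) (coin (s + 1)) (fun j => sent s j i) (status s i) (status (s + 1) i)
  /-- an honest committee member that has not ended broadcasts its vote for its current bit and
  its value (and nothing else); one that has ended is silent -/
  broadcast : ∀ s i j, 4 ≤ s → i ∉ byz → i ∈ comm s →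
    sent s i j = {x | ∃ b, status s i = .running b ∧ x = (b, (input i).value)}

/-- What a replica hands to the client: its input to BBA*, the votes it received (`received s j` are
the votes of step `s` signed by `j`), and its output if it has one. -/
structure Response (V : Type*) (n : ℕ) where
  input : GradedOutput V
  received : ℕ → Fin n → Set (Vote V)
  output : Option (Vote V)

/-- The data that the client collects: the responses of some of the replicas. -/
abbrev Evidence (V : Type*) (n : ℕ) := Fin n → Option (Response V n)

namespace Execution

variable {V : Type*} {n tH : ℕ} {comm : ℕ → Finset (Fin n)} {coin : ℕ → Bool}
  {byz : Finset (Fin n)}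

/-- Replica `i` outputs `o`. -/
def Outputs (E : Execution V n tH comm coin byz) (i : Fin n) (o : Vote V) : Prop :=
  ∃ s, 4 ≤ s ∧ E.status s i = .ended o

/-- Two honest replicas output conflicting values. -/
def Conflict (E : Execution V n tH comm coin byz) : Prop :=
  ∃ i j o o', i ∉ byz ∧ j ∉ byz ∧ E.Outputs i o ∧ E.Outputs j o' ∧ o ≠ o'

/-- The truthful response of replica `i`. -/
def Truthful (E : Execution V n tH comm coin byz) (i : Fin n) (r : Response V n) : Prop :=
  r.input = E.input i ∧ (∀ s j, r.received s j = E.sent s j i) ∧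
    ∀ o, r.output = some o ↔ E.Outputs i o

/-- The responses that a Byzantine replica is able to produce: it may omit votes and present votes
that the Byzantine replicas never sent, but it can neither forge the signature of an honest replica
nor the proof of membership in a committee. -/
def Producible (E : Execution V n tH comm coin byz) (r : Response V n) : Prop :=
  ∀ s j x, x ∈ r.received s j →
    4 ≤ s ∧ j ∈ comm s ∧ (j ∉ byz → ∃ i, x ∈ E.sent s j i)

/-- `ev` is a possible outcome of the collection of transcripts in the execution `E`. -/
def Presents (E : Execution V n tH comm coin byz) (ev : Evidence V n) : Prop :=
  ∀ i r, ev i = some r → (i ∉ byz → E.Truthful i r) ∧ (i ∈ byz → E.Producible r)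

end Execution

/-- The number of honest replicas whose transcripts the evidence contains. -/
noncomputable def honestResponses {V : Type*} {n : ℕ} (byz : Finset (Fin n))
    (ev : Evidence V n) : ℕ :=
  {i : Fin n | i ∉ byz ∧ ev i ≠ none}.ncard

/-- A forensic protocol: it maps the evidence to the set of replicas held culpable. It may also use
the committees (which the client can verify) and the coins. -/
abbrev Client (V : Type*) (n : ℕ) :=
  (ℕ → Finset (Fin n)) → (ℕ → Bool) → Evidence V n → Finset (Fin n)

/-- The client never holds an honest replica culpable, whatever happens in an execution with these
committees, coins and Byzantine replicas. -/
def Client.Sound {V : Type*} {n : ℕ} (A : Client V n) (tH : ℕ) (comm : ℕ → Finset (Fin n))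
    (coin : ℕ → Bool) (byz : Finset (Fin n)) : Prop :=
  ∀ (E : Execution V n tH comm coin byz) (ev : Evidence V n), E.Presents ev →
    A comm coin ev ⊆ byz

/-- Whenever two honest replicas output conflicting values and the client has the transcripts of
`k` honest replicas, it identifies at least `d` Byzantine replicas and accuses no honest one. -/
def Client.Identifies {V : Type*} {n : ℕ} (A : Client V n) (tH k d : ℕ)
    (comm : ℕ → Finset (Fin n)) (coin : ℕ → Bool) (byz : Finset (Fin n)) : Prop :=
  ∀ (E : Execution V n tH comm coin byz) (ev : Evidence V n), E.Conflict → E.Presents ev →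
    k ≤ honestResponses byz ev → A comm coin ev ⊆ byz ∧ d ≤ (A comm coin ev).card

section Randomness

variable {Ω : Type*} [MeasurableSpace Ω]

/-- Ideal cryptographic self-selection and ideal global coin: every replica is in the committee of
every step with probability `q`, every coin is fair, and all these choices are independent. -/
structure IdealRandomness {n : ℕ} (μ : Measure Ω) (comm : Ω → ℕ → Finset (Fin n))
    (coin : Ω → ℕ → Bool) (q : ℝ) : Prop where
  measurable_comm : ∀ s i, MeasurableSet {ω | i ∈ comm ω s}
  measurable_coin : ∀ s, MeasurableSet {ω | coin ω s = true}
  prob_comm : ∀ s i, μ {ω | i ∈ comm ω s} = ENNReal.ofReal q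
  prob_coin : ∀ s, μ {ω | coin ω s = true} = 1 / 2
  indep : iIndepSet
    (Sum.elim (fun x : ℕ × Fin n => {ω | x.2 ∈ comm ω x.1}) (fun s : ℕ => {ω | coin ω s = true})) μ

/-- `(m, k, d)`-identification of culprits with error probability at most `δ`: against every set of
more than `t` and at most `m` Byzantine replicas, the client identifies `d` culprits after a safety
violation from the transcripts of `k` honest replicas. Nothing is asked of the client in other
executions. -/
def CulpritIdentification (V : Type*) {n : ℕ} (tH t m k d : ℕ) (δ : ℝ≥0∞) (μ : Measure Ω)
    (comm : Ω → ℕ → Finset (Fin n)) (coin : Ω → ℕ → Bool) : Prop :=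
  ∃ A : Client V n, ∀ byz : Finset (Fin n), t < byz.card → byz.card ≤ m →
    μ {ω | ¬ A.Identifies tH k d (comm ω) (coin ω) byz} ≤ δ

/-- `(m, k, d)`-forensic support with error probability at most `δ`: in addition the accusations are
irrefutable, that is, correct in all executions, without any assumption on the number of honest
replicas. -/
def ForensicSupport (V : Type*) {n : ℕ} (tH t m k d : ℕ) (δ : ℝ≥0∞) (μ : Measure Ω)
    (comm : Ω → ℕ → Finset (Fin n)) (coin : Ω → ℕ → Bool) : Prop :=
  ∃ A : Client V n,
    (∀ byz : Finset (Fin n), μ {ω | ¬ A.Sound tH (comm ω) (coin ω) byz} ≤ δ) ∧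
    ∀ byz : Finset (Fin n), t < byz.card → byz.card ≤ m →
      μ {ω | ¬ A.Identifies tH k d (comm ω) (coin ω) byz} ≤ δ

end Randomness

end Algorand

/-! The failure is one of indistinguishability. Suppose the first `tH` replicas are in all
committees of the steps 4 to 8, and split them into two halves that do not hear each other at the
steps 4 and 5. The high replicas `tH ≤ i` receive all `tH` votes `(0, v)` and end at once. Every low
replica misses at least one vote, falls to bit 1 at step 6, where 1 is the default, and the low
replicas, now reunited, end with `(1, v_⊥)`.

The silence between the halves can be blamed on either one, and each has at most `t + 1` members
because `tH ≤ 2 * t + 1`. The run and the transcripts (`attack_step`, `attackEvidence`) do not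
mention the Byzantine set, so they fit every set that contains a half and leaves honest replicas on
both sides of the conflict. For each replica `e` such a set avoids `e` (`exists_culprits`), so a
correct client accuses nobody, against `d > 0`.

The committee event has a fixed positive probability `p`. On it the client fails against some set of
size `t + 1`, which may vary with the outcome; a union bound over these finitely many sets excludes
a small enough error. -/

namespace Algorand

/-! ### Reaching and just missing the threshold `tH`. -/

section Counting

variable {V : Type*} {n tH : ℕ}

theorem ncard_val_lt (h : tH ≤ n) : {j : Fin n | (j : ℕ) < tH}.ncard = tH := by
  have : {j : Fin n | (j : ℕ) < tH} = Set.range (Fin.castLE h) := by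
    ext j
    simp only [Set.mem_ofPred_eq, Set.mem_range]
    exact ⟨fun hj => ⟨⟨j, hj⟩, rfl⟩, by rintro ⟨k, rfl⟩; exact k.2⟩
  rw [this, ← Set.image_univ, Set.ncard_image_of_injective _ (Fin.castLE_injective h)]
  simp

theorem le_votes (h : tH ≤ n) {recv : Fin n → Set (Vote V)} {p : Vote V → Prop}
    (hp : ∀ j : Fin n, (j : ℕ) < tH → ∃ x ∈ recv j, p x) : tH ≤ votes recv p := by
  conv_lhs => rw [← ncard_val_lt h]
  exact Set.ncard_le_ncard (fun j hj => hp j hj) (Set.toFinite _)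

/-- The possible supporters number exactly `tH`, so a single silent one suffices to miss the
threshold. -/
theorem votes_lt (h : tH ≤ n) {recv : Fin n → Set (Vote V)} {p : Vote V → Prop}
    (hp : ∀ j : Fin n, ∀ x ∈ recv j, p x → (j : ℕ) < tH)
    {j₀ : Fin n} (hj₀ : (j₀ : ℕ) < tH) (hempty : recv j₀ = ∅) : votes recv p < tH := by
  conv_rhs => rw [← ncard_val_lt h]
  refine Set.ncard_lt_ncard ⟨?_, fun hsub => ?_⟩ (Set.toFinite _)
  · rintro j ⟨x, hx, hpx⟩
    exact hp j x hx hpx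
  · obtain ⟨x, hx, -⟩ := hsub (show j₀ ∈ {j : Fin n | (j : ℕ) < tH} from hj₀)
    simp [hempty] at hx

theorem votes_eq_zero {recv : Fin n → Set (Vote V)} {p : Vote V → Prop}
    (hp : ∀ j, ∀ x ∈ recv j, ¬ p x) : votes recv p = 0 := by
  have : {j : Fin n | ∃ x ∈ recv j, p x} = ∅ := by
    ext j
    simpa using fun b v hx => hp j (b, v) hx
  rw [votes, this, Set.ncard_empty]

end Counting

/-! ### An attack that leaves no evidence

The replicas `i < tH` start with the bit `0` and the others with the bit `1`. Between the two halves
of the former, all votes of the steps 4 and 5 are lost. The replicas `tH ≤ i` output `(0, v)` at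
step 5, and the others output `(1, v_⊥)` at step 9. Each half may be the one to blame. -/
section Attack

variable {V : Type*} {n : ℕ} (tH : ℕ) (v : V) (comm : ℕ → Finset (Fin n))

/-- The votes between `i` and `j` are lost at the steps 4 and 5. -/
def Separated (i j : Fin n) : Prop :=
  ((i : ℕ) < tH / 2 ∧ tH / 2 ≤ (j : ℕ) ∧ (j : ℕ) < tH) ∨
  ((j : ℕ) < tH / 2 ∧ tH / 2 ≤ (i : ℕ) ∧ (i : ℕ) < tH)

/-- Grades 2 and 1 with a common value are a legitimate result of graded consensus, yet give
different bits. -/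
def attackInput (i : Fin n) : GradedOutput V :=
  ⟨some v, if (i : ℕ) < tH then 2 else 1⟩

theorem bit_attackInput (i : Fin n) : (attackInput tH v i).bit = !decide ((i : ℕ) < tH) := by
  by_cases h : (i : ℕ) < tH <;> simp [attackInput, GradedOutput.bit, h]

/-- The votes that `i` receives from `j` at step 4. -/
def firstReceived (i j : Fin n) : Set (Vote V) :=
  {x | j ∈ comm 4 ∧ ¬ Separated tH j i ∧ x = (!decide ((j : ℕ) < tH), some v)}

/-- The bit of a low replica at step 5 depends on how many high replicas are in the committee of
step 4, and is left unevaluated: step 6 erases it. Using `firstReceived` avoids a circular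
definition, since the received votes are defined from the statuses. -/
noncomputable def attackStatus (s : ℕ) (i : Fin n) : Status V :=
  if (i : ℕ) < tH then
    if s ≤ 4 then .running false
    else if s = 5 then .running (newBit tH 5 false (firstReceived tH v comm i))
    else if s ≤ 8 then .running true
    else .ended (true, none)
  else if s ≤ 4 then .running true
  else .ended (false, some v)

def attackVotes (s : ℕ) (j : Fin n) : Set (Vote V) :=
  {x | 4 ≤ s ∧ j ∈ comm s ∧ ∃ b, attackStatus tH v comm s j = .running b ∧ x = (b, some v)}

/-- The votes of step `s` that `i` receives from `j`. -/
def attackReceived (s : ℕ) (j i : Fin n) : Set (Vote V) :=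
  {x | x ∈ attackVotes tH v comm s j ∧ ¬ (s ≤ 5 ∧ Separated tH j i)}

def attackOutput (i : Fin n) : Vote V :=
  if (i : ℕ) < tH then (true, none) else (false, some v)

/-- All replicas respond, and nothing here depends on who is Byzantine. -/
def attackEvidence : Evidence V n := fun i =>
  some ⟨attackInput tH v i, fun s j => attackReceived tH v comm s j i, some (attackOutput tH v i)⟩

variable {tH v comm}

theorem exists_separated (h2 : 2 ≤ tH) (hn : tH ≤ n) {i : Fin n} (hi : (i : ℕ) < tH) :
    ∃ j : Fin n, (j : ℕ) < tH ∧ Separated tH j i := by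
  by_cases h : (i : ℕ) < tH / 2
  · exact ⟨⟨tH / 2, by omega⟩, by simp only; omega, .inr ⟨h, le_rfl, by simp only; omega⟩⟩
  · exact ⟨⟨0, by omega⟩, by simp only; omega, .inl ⟨by simp only; omega, by omega, hi⟩⟩

theorem attackReceived_four (i : Fin n) :
    (fun j => attackReceived tH v comm 4 j i) = firstReceived tH v comm i := by
  funext j
  ext x
  by_cases h : (j : ℕ) < tH <;>
    simp [attackReceived, attackVotes, firstReceived, attackStatus, h] <;> tauto

theorem attackReceived_of_separated {s : ℕ} {i j : Fin n} (hs : s ≤ 5) (h : Separated tH j i) :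
    attackReceived tH v comm s j i = ∅ := by
  ext x
  simp [attackReceived, hs, h]

theorem lt_of_mem_attackReceived {s : ℕ} {i j : Fin n} {x : Vote V} (hs : 5 ≤ s)
    (hx : x ∈ attackReceived tH v comm s j i) : (j : ℕ) < tH := by
  obtain ⟨⟨-, -, b, hb, -⟩, -⟩ := hx
  by_contra h
  simp [attackStatus, h, show ¬ s ≤ 4 by omega] at hb

theorem fst_of_mem_attackReceived {s : ℕ} {i j : Fin n} {x : Vote V} (hs : 6 ≤ s)
    (hx : x ∈ attackReceived tH v comm s j i) : x.1 = true := by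
  have h := lt_of_mem_attackReceived (by omega) hx
  obtain ⟨⟨-, -, b, hb, rfl⟩, -⟩ := hx
  simp only [attackStatus, h, if_true, show ¬ s ≤ 4 by omega, show ¬ s = 5 by omega,
    if_false] at hb
  split_ifs at hb
  cases hb
  rfl

theorem true_mem_attackReceived {s : ℕ} {i j : Fin n} (hs : 6 ≤ s) (hs' : s ≤ 8)
    (hj : (j : ℕ) < tH) (hc : j ∈ comm s) : (true, some v) ∈ attackReceived tH v comm s j i := by
  refine ⟨⟨by omega, hc, true, ?_, rfl⟩, by omega⟩
  simp [attackStatus, hj, show ¬ s ≤ 4 by omega, show ¬ s = 5 by omega, hs']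

/-- All replicas, Byzantine ones included, update correctly from what they receive, so the culprits
can be chosen afterwards. The coin is arbitrary: at step 7, the only coin step at which low replicas
are running, `tH` votes for 1 decide. -/
theorem attack_step (h2 : 2 ≤ tH) (hn : tH ≤ n)
    (hc : ∀ s, 4 ≤ s → s ≤ 8 → ∀ j : Fin n, (j : ℕ) < tH → j ∈ comm s)
    (coin : Bool) (s : ℕ) (hs : 4 ≤ s) (i : Fin n) :
    Next tH (s + 1) coin (fun j => attackReceived tH v comm s j i)
      (attackStatus tH v comm s i) (attackStatus tH v comm (s + 1) i) := by
  have late_one : 6 ≤ s → s ≤ 8 →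
      tH ≤ votes (fun j => attackReceived tH v comm s j i) (fun x => x.1 = true) :=
    fun h6 h8 => le_votes hn fun j hj =>
      ⟨_, true_mem_attackReceived h6 h8 hj (hc s hs h8 j hj), rfl⟩
  have late_zero : 6 ≤ s → ∀ p : Vote V → Prop, (∀ x, p x → x.1 = false) →
      votes (fun j => attackReceived tH v comm s j i) p = 0 := fun h6 p hp =>
    votes_eq_zero fun j x hx hpx => by
      have := fst_of_mem_attackReceived h6 hx
      simp [hp x hpx] at this
  by_cases hi : (i : ℕ) < tH
  · obtain ⟨j₀, hj₀, hsep⟩ := exists_separated h2 hn hi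
    obtain rfl | rfl | rfl | rfl | rfl | h9 : s = 4 ∨ s = 5 ∨ s = 6 ∨ s = 7 ∨ s = 8 ∨ 9 ≤ s := by
      omega
    · have e4 : attackStatus tH v comm 4 i = .running false := by simp [attackStatus, hi]
      rw [e4]
      refine Or.inr ⟨?_, ?_⟩
      · rintro o (⟨-, ho, hle⟩ | ⟨h, -⟩)
        · refine absurd hle (not_le.2 (votes_lt hn ?_ hj₀
            (attackReceived_of_separated (by norm_num) hsep)))
          rintro j x ⟨⟨-, -, b, hb, rfl⟩, -⟩ rfl
          by_contra hj
          simp only [attackStatus, hj, if_false, le_refl, if_true] at hb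
          cases hb
          simp at ho
        · omega
      · rw [attackReceived_four]
        simp [attackStatus, hi, newBit]
    · have e5 : ∃ b, attackStatus tH v comm 5 i = .running b :=
        ⟨newBit tH 5 false (firstReceived tH v comm i), by simp [attackStatus, hi]⟩
      obtain ⟨b, e5⟩ := e5
      -- The high replicas have ended, so only low ones vote at step 5 and one of them is unheard.
      -- No threshold is met, and the default bit 1 applies.
      have few : ∀ p, votes (fun j => attackReceived tH v comm 5 j i) p < tH := fun p =>
        votes_lt hn (fun j x hx _ => lt_of_mem_attackReceived le_rfl hx) hj₀
          (attackReceived_of_separated le_rfl hsep)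
      rw [e5]
      refine Or.inr ⟨?_, ?_⟩
      · rintro o (⟨h, -⟩ | ⟨-, -, hle⟩)
        · omega
        · exact absurd hle (not_le.2 (few _))
      · simp [attackStatus, hi, newBit, few]
    · have e6 : attackStatus tH v comm 6 i = .running true := by simp [attackStatus, hi]
      rw [e6]
      refine Or.inr ⟨?_, ?_⟩
      · rintro o (⟨h, -⟩ | ⟨h, -⟩) <;> omega
      · have h0 := late_zero (by norm_num) (fun x => x.1 = false) fun _ h => h
        have h1 := late_one (by norm_num) (by norm_num)
        simp [attackStatus, hi, newBit, h0, h1, show tH ≠ 0 by omega]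
    · have e7 : attackStatus tH v comm 7 i = .running true := by simp [attackStatus, hi]
      rw [e7]
      refine Or.inr ⟨?_, ?_⟩
      · rintro o (⟨-, ho, hle⟩ | ⟨h, -⟩)
        · rw [late_zero (by norm_num) (fun x => x = o) (by rintro x rfl; exact ho)] at hle
          omega
        · omega
      · have h1 := late_one (by norm_num) (by norm_num)
        simp [attackStatus, hi, newBit, h1]
    · have e8 : attackStatus tH v comm 8 i = .running true := by simp [attackStatus, hi]
      rw [e8]
      refine Or.inl ⟨(true, none), .inr ⟨by norm_num, rfl, late_one (by norm_num) le_rfl⟩, ?_⟩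
      simp [attackStatus, hi]
    · have e : ∀ r, 9 ≤ r → attackStatus tH v comm r i = .ended (true, none) := fun r hr => by
        simp [attackStatus, hi, show ¬ r ≤ 4 by omega, show ¬ r = 5 by omega,
          show ¬ r ≤ 8 by omega]
      rw [e s h9, e (s + 1) (by omega)]
      rfl
  · have e : ∀ r, 5 ≤ r → attackStatus tH v comm r i = .ended (false, some v) := fun r hr => by
      simp [attackStatus, hi, show ¬ r ≤ 4 by omega]
    rw [e (s + 1) (by omega)]
    obtain rfl | h5 : s = 4 ∨ 5 ≤ s := by omega
    · have e4 : attackStatus tH v comm 4 i = .running true := by simp [attackStatus, hi]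
      rw [e4]
      refine Or.inl ⟨(false, some v), .inl ⟨by norm_num, rfl, le_votes hn fun j hj => ?_⟩, rfl⟩
      refine ⟨_, ⟨⟨le_rfl, hc 4 le_rfl (by norm_num) j hj, false, ?_, rfl⟩, ?_⟩, rfl⟩
      · simp [attackStatus, hj]
      · rintro ⟨-, ⟨-, -, h⟩ | ⟨h, -⟩⟩ <;> omega
    · rw [e s h5]
      rfl

open Classical in
/-- The attack with the Byzantine replicas `byz`, which have to contain one of the halves. -/
noncomputable def attack (h2 : 2 ≤ tH) (hn : tH ≤ n)
    (hc : ∀ s, 4 ≤ s → s ≤ 8 → ∀ j : Fin n, (j : ℕ) < tH → j ∈ comm s) (coin : ℕ → Bool)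
    (byz : Finset (Fin n)) (hsep : ∀ i j, i ∉ byz → j ∉ byz → ¬ Separated tH j i) :
    Execution V n tH comm coin byz where
  input := attackInput tH v
  status := attackStatus tH v comm
  -- Byzantine replicas only withhold votes; by `hsep` no vote between honest replicas needs to be
  -- lost.
  sent s j i := if j ∈ byz then attackReceived tH v comm s j i else attackVotes tH v comm s j
  graded_value i _ := by
    by_cases h : (i : ℕ) < tH <;> simp [attackInput, h]
  graded_close i j _ _ := by
    by_cases h : (i : ℕ) < tH <;> by_cases h' : (j : ℕ) < tH <;> simp [attackInput, h, h']
  graded_agree i j _ _ _ _ := rfl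
  selected s i j x hx := by
    split_ifs at hx
    · exact ⟨hx.1.1, hx.1.2.1⟩
    · exact ⟨hx.1, hx.2.1⟩
  start i _ := by
    rw [bit_attackInput]
    by_cases h : (i : ℕ) < tH <;> simp [attackStatus, h]
  step s i hs hi := by
    have : (fun j => if j ∈ byz then attackReceived tH v comm s j i
        else attackVotes tH v comm s j) = fun j => attackReceived tH v comm s j i := by
      funext j
      split_ifs with hj
      · rfl
      · ext x
        simp [attackReceived, hsep i j hi hj]
    rw [this]
    exact attack_step h2 hn hc _ s hs i
  broadcast s i j hs hi hci := by
    ext x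
    simp [hi, attackVotes, hs, hci, attackInput]

variable {h2 : 2 ≤ tH} {hn : tH ≤ n}
  {hc : ∀ s, 4 ≤ s → s ≤ 8 → ∀ j : Fin n, (j : ℕ) < tH → j ∈ comm s} {coin : ℕ → Bool}
  {byz : Finset (Fin n)} {hsep : ∀ i j, i ∉ byz → j ∉ byz → ¬ Separated tH j i}

theorem attack_outputs (i : Fin n) (o : Vote V) :
    (attack (v := v) h2 hn hc coin byz hsep).Outputs i o ↔ o = attackOutput tH v i := by
  constructor
  · rintro ⟨s, hs, h⟩
    change attackStatus tH v comm s i = _ at h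
    rw [attackStatus] at h
    rw [attackOutput]
    split_ifs at h ⊢ <;> cases h <;> rfl
  · rintro rfl
    refine ⟨9, by norm_num, ?_⟩
    change attackStatus tH v comm 9 i = _
    by_cases h : (i : ℕ) < tH <;> simp [attackStatus, attackOutput, h]

theorem attack_presents :
    (attack (v := v) h2 hn hc coin byz hsep).Presents (attackEvidence tH v comm) := by
  rintro i r hr
  obtain rfl := Option.some.inj hr
  refine ⟨fun hi => ⟨rfl, fun s j => ?_, fun o => ?_⟩, fun hi s j x hx => ?_⟩
  · change _ = if j ∈ byz then _ else _
    split_ifs with hj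
    · rfl
    · ext x
      simp [attackReceived, hsep i j hi hj]
  · rw [attack_outputs]
    simp [eq_comm]
  · refine ⟨hx.1.1, hx.1.2.1, fun hj => ⟨i, ?_⟩⟩
    change x ∈ if j ∈ byz then _ else _
    rw [if_neg hj]
    exact hx.1

theorem attack_conflict {i j : Fin n} (hi : i ∉ byz) (hj : j ∉ byz) (hlt : (i : ℕ) < tH)
    (hle : tH ≤ (j : ℕ)) : (attack (v := v) h2 hn hc coin byz hsep).Conflict :=
  ⟨i, j, _, _, hi, hj, (attack_outputs i _).2 rfl, (attack_outputs j _).2 rfl, by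
    simp [attackOutput, hlt, not_lt.2 hle]⟩

theorem honestResponses_attackEvidence :
    honestResponses byz (attackEvidence tH v comm) = n - byz.card := by
  have : {i : Fin n | i ∉ byz ∧ attackEvidence tH v comm i ≠ none} =
      ((byzᶜ : Finset _) : Set _) := by
    ext i
    simp [attackEvidence]
  rw [honestResponses, this, Set.ncard_coe_finset, Finset.card_compl, Fintype.card_fin]

end Attack

/-- For every replica `e` there is a set of culprits for the attack that does not contain `e`. -/
theorem exists_culprits {t tH : ℕ} (ht : 1 ≤ t) (h2 : 2 ≤ tH) (hle : tH ≤ 2 * t + 1)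
    (e : Fin (3 * t + 1)) :
    ∃ byz : Finset (Fin (3 * t + 1)), byz.card = t + 1 ∧ e ∉ byz ∧
      (∀ i j, i ∉ byz → j ∉ byz → ¬ Separated tH j i) ∧
      (∃ i ∉ byz, (i : ℕ) < tH) ∧ ∃ j ∉ byz, tH ≤ (j : ℕ) := by
  -- `a` and `b` are kept honest to witness the conflict, and one of them is `e`. The half without
  -- `a` is blamed.
  obtain ⟨a, b, ha, hb, he⟩ : ∃ a b : Fin (3 * t + 1), (a : ℕ) < tH ∧ tH ≤ (b : ℕ) ∧
      (e = a ∨ e = b) := by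
    by_cases h : (e : ℕ) < tH
    · exact ⟨e, ⟨3 * t, by omega⟩, h, by simp only; omega, .inl rfl⟩
    · exact ⟨⟨0, by omega⟩, e, by simp only; omega, by omega, .inr rfl⟩
  obtain ⟨S, hS, haS, hbS, hsep⟩ : ∃ S : Finset (Fin (3 * t + 1)), S.card ≤ t + 1 ∧ a ∉ S ∧
      b ∉ S ∧ ∀ i j, i ∉ S → j ∉ S → ¬ Separated tH j i := by
    by_cases h : (a : ℕ) < tH / 2
    · refine ⟨Finset.univ.filter fun i => tH / 2 ≤ (i : ℕ) ∧ (i : ℕ) < tH, ?_, ?_, ?_, ?_⟩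
      · have : (Finset.univ.filter fun i : Fin (3 * t + 1) =>
            tH / 2 ≤ (i : ℕ) ∧ (i : ℕ) < tH).card ≤ (Finset.Ico (tH / 2) tH).card :=
          Finset.card_le_card_of_injOn (fun i => (i : ℕ)) (fun i hi => by simpa using hi)
            (fun i _ j _ h => Fin.ext h)
        rw [Nat.card_Ico] at this
        omega
      · simp only [Finset.mem_filter, Finset.mem_univ, true_and]; omega
      · simp only [Finset.mem_filter, Finset.mem_univ, true_and]; omega
      · simp only [Finset.mem_filter, Finset.mem_univ, true_and, Separated]; omega
    · refine ⟨Finset.univ.filter fun i => (i : ℕ) < tH / 2, ?_, ?_, ?_, ?_⟩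
      · have : (Finset.univ.filter fun i : Fin (3 * t + 1) => (i : ℕ) < tH / 2).card ≤
            (Finset.range (tH / 2)).card :=
          Finset.card_le_card_of_injOn (fun i => (i : ℕ)) (fun i hi => by simpa using hi)
            (fun i _ j _ h => Fin.ext h)
        rw [Finset.card_range] at this
        omega
      · simp only [Finset.mem_filter, Finset.mem_univ, true_and]; omega
      · simp only [Finset.mem_filter, Finset.mem_univ, true_and]; omega
      · simp only [Finset.mem_filter, Finset.mem_univ, true_and, Separated]; omega
  have hsub : S ⊆ ({a, b} : Finset _)ᶜ := by
    intro i hi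
    simp only [Finset.mem_compl, Finset.mem_insert, Finset.mem_singleton]
    rintro (rfl | rfl) <;> contradiction
  -- Room for padding the half to size `t + 1`: `3 * t - 1 ≥ t + 1` uses `1 ≤ t`.
  have hcard : t + 1 ≤ (({a, b} : Finset (Fin (3 * t + 1)))ᶜ).card := by
    rw [Finset.card_compl, Fintype.card_fin]
    have := Finset.card_le_two (a := a) (b := b)
    omega
  obtain ⟨B, hSB, hBc, hB⟩ := Finset.exists_subsuperset_card_eq hsub hS hcard
  have ha' : a ∉ B := fun h => by simpa using hBc h
  have hb' : b ∉ B := fun h => by simpa using hBc h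
  refine ⟨B, hB, by rcases he with rfl | rfl <;> assumption,
    fun i j hi hj => hsep i j (fun h => hi (hSB h)) (fun h => hj (hSB h)),
    ⟨a, ha', ha⟩, ⟨b, hb', hb⟩⟩

/-- If the replicas `i < tH` are in the committees of the steps `4, …, 8`, no client identifies
a culprit against all sets of `t + 1` Byzantine replicas. -/
theorem exists_not_identifies {V : Type*} [Nonempty V] {t tH d : ℕ} (ht : 1 ≤ t) (h2 : 2 ≤ tH)
    (hle : tH ≤ 2 * t + 1) (hd : 0 < d) (A : Client V (3 * t + 1))
    {comm : ℕ → Finset (Fin (3 * t + 1))} {coin : ℕ → Bool}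
    (hc : ∀ s, 4 ≤ s → s ≤ 8 → ∀ j : Fin (3 * t + 1), (j : ℕ) < tH → j ∈ comm s) :
    ∃ byz : Finset (Fin (3 * t + 1)), byz.card = t + 1 ∧
      ¬ A.Identifies tH (2 * t) d comm coin byz := by
  obtain ⟨v⟩ := ‹Nonempty V›
  by_contra! hA
  have key : ∀ e, e ∉ A comm coin (attackEvidence tH v comm) ∧
      d ≤ (A comm coin (attackEvidence tH v comm)).card := by
    -- The evidence is fixed before `e`; only the Byzantine set that explains it varies.
    intro e
    obtain ⟨byz, hcard, he, hsep, ⟨i, hi, hlt⟩, j, hj, hge⟩ := exists_culprits ht h2 hle e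
    obtain ⟨hsub, hd'⟩ := hA byz hcard (attack (v := v) h2 (by omega) hc coin byz hsep)
      (attackEvidence tH v comm) (attack_conflict hi hj hlt hge) attack_presents
      (by rw [honestResponses_attackEvidence]; omega)
    exact ⟨fun h => he (hsub h), hd'⟩
  have hpos : 0 < (A comm coin (attackEvidence tH v comm)).card := hd.trans_le (key 0).2
  obtain ⟨e, he⟩ := Finset.card_pos.1 hpos
  exact (key e).1 he

/-! ### Probability of the committee event. -/

section Probability

variable {Ω : Type*} [MeasurableSpace Ω] {n : ℕ} {μ : Measure Ω}
  {comm : Ω → ℕ → Finset (Fin n)} {coin : Ω → ℕ → Bool} {q : ℝ}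

/-- The probability that given replicas are in the committees of given steps. -/
theorem IdealRandomness.measure_mem_comm (h : IdealRandomness μ comm coin q)
    (S : Finset (ℕ × Fin n)) :
    μ {ω | ∀ x ∈ S, x.2 ∈ comm ω x.1} = ENNReal.ofReal q ^ S.card := by
  have := h.indep.meas_biInter (S.map Function.Embedding.inl)
  simp only [Finset.prod_map, Function.Embedding.inl_apply, Sum.elim_inl, h.prob_comm,
    Finset.prod_const] at this
  rw [← this]
  congr 1
  ext ω
  simp only [Set.mem_ofPred_eq, Set.mem_iInter, Finset.mem_map]
  exact ⟨by rintro hω _ ⟨x, hx, rfl⟩; exact hω x hx, fun hω x hx => hω _ ⟨x, hx, rfl⟩⟩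

end Probability

end Algorand

theorem theorem6p1 (V : Type*) [Nonempty V] (t tH : ℕ) (κ : ℝ)
    (ht : 1 ≤ t) (hκ : 0 < κ) (hκn : κ ≤ ((3 * t + 1 : ℕ) : ℝ))
    (htH_two : 2 ≤ tH) (htH_lower : 2 * κ / 3 ≤ (tH : ℝ)) (htH_upper : tH ≤ 2 * t + 1) :
    ∃ δ : ℝ≥0∞, 0 < δ ∧
      ∀ (Ω : Type*) [MeasurableSpace Ω] (μ : Measure Ω) [IsProbabilityMeasure μ]
        (comm : Ω → ℕ → Finset (Fin (3 * t + 1))) (coin : Ω → ℕ → Bool),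
        Algorand.IdealRandomness μ comm coin (κ / ((3 * t + 1 : ℕ) : ℝ)) →
        ∀ d : ℕ, 0 < d →
          ¬ Algorand.ForensicSupport V tH t (t + 1) (2 * t) d δ μ comm coin ∧
          ¬ Algorand.CulpritIdentification V tH t (t + 1) (2 * t) d δ μ comm coin := by
  classical
  let S : Finset (ℕ × Fin (3 * t + 1)) :=
    Finset.Icc 4 8 ×ˢ Finset.univ.filter fun j : Fin (3 * t + 1) => (j : ℕ) < tH
  let p : ℝ≥0∞ := ENNReal.ofReal (κ / ((3 * t + 1 : ℕ) : ℝ)) ^ S.card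
  let W : Finset (Finset (Fin (3 * t + 1))) := Finset.univ.filter fun B => B.card = t + 1
  have hq : 0 < κ / ((3 * t + 1 : ℕ) : ℝ) := by positivity
  have hp : p ≠ 0 := pow_ne_zero _ (ENNReal.ofReal_pos.2 hq).ne'
  have hp' : p ≠ ⊤ := ENNReal.pow_ne_top ENNReal.ofReal_ne_top
  -- The `+ 1` makes `W.card` times the error strictly smaller than `p`.
  refine ⟨p / (W.card + 1 : ℕ), ENNReal.div_pos hp (ENNReal.natCast_ne_top _), ?_⟩
  intro Ω _ μ _ comm coin hR d hd
  suffices hmain : ¬ Algorand.CulpritIdentification V tH t (t + 1) (2 * t) d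
      (p / (W.card + 1 : ℕ)) μ comm coin from
    ⟨fun ⟨A, _, hA⟩ => hmain ⟨A, hA⟩, hmain⟩
  rintro ⟨A, hA⟩
  have hcover : {ω | ∀ x ∈ S, x.2 ∈ comm ω x.1} ⊆
      ⋃ B ∈ W, {ω | ¬ A.Identifies tH (2 * t) d (comm ω) (coin ω) B} := by
    intro ω hω
    obtain ⟨B, hB, hfail⟩ := Algorand.exists_not_identifies (coin := coin ω) ht htH_two htH_upper
      hd A (comm := comm ω) fun s h4 h8 j hj => hω (s, j) (by simp [S, h4, h8, hj])
    simp only [Set.mem_iUnion]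
    exact ⟨B, by simp [W, hB], hfail⟩
  have hle : p ≤ W.card * (p / (W.card + 1 : ℕ)) :=
    calc p = μ {ω | ∀ x ∈ S, x.2 ∈ comm ω x.1} := (hR.measure_mem_comm S).symm
      _ ≤ ∑ B ∈ W, μ {ω | ¬ A.Identifies tH (2 * t) d (comm ω) (coin ω) B} :=
        (measure_mono hcover).trans (measure_biUnion_finset_le _ _)
      _ ≤ ∑ B ∈ W, p / (W.card + 1 : ℕ) := Finset.sum_le_sum fun B hB => by
        have : B.card = t + 1 := by simpa [W] using hB
        exact hA B (by omega) (by omega)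
      _ = W.card * (p / (W.card + 1 : ℕ)) := by rw [Finset.sum_const, nsmul_eq_mul]
  have hlt : (W.card : ℝ≥0∞) * (p / (W.card + 1 : ℕ)) < p := by
    rw [← mul_div_assoc, ENNReal.div_lt_iff (.inl (by simp)) (.inl (ENNReal.natCast_ne_top _)),
      mul_comm]
    exact (ENNReal.mul_lt_mul_iff_right hp hp').2 (by exact_mod_cast Nat.lt_succ_self _)
  exact absurd hle (not_le.2 hlt)
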